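/- Let $K$ be an algebraically closed field and let $K^{n,n,n}$ be the space of $n\times n\times n$ arrays over $K$. For $T\in K^{n,n,n}$ the subrank ${\rm Q}(T)$ is the largest $r\ge 0$ for which there are matrices $A,B,C\in K^{r\times n}$ such that for all $i,j,k\in\{1,\dots,r\}$ the sum $\sum_{a,b,c=1}^n A_{ia}B_{jb}C_{kc}T_{abc}$ equals $1$ if $i=j=k$ and $0$ otherwise. For every integer $n\ge 0$ there is a unique integer ${\rm Q}(n)$, the generic subrank, such that ${\rm Q}(T)={\rm Q}(n)$ for all $T$ in some non-empty Zariski-open subset of $K^{n,n,n}$, and $$ {\rm Q}(n)\ \ge\ 3\left\lfloor \sqrt{\tfrac n3+\tfrac14}-\tfrac12\right\rfloor . $$ Moreover ${\rm Q}(n)=\Theta(\sqrt n)$ as $n\to\infty$. -/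

import Mathlib

open Filter Asymptotics

/-- The space `K^{n₁,n₂,n₃}` of three-dimensional arrays with entries in `K`. -/
abbrev Tensor3 (K : Type*) (n₁ n₂ n₃ : ℕ) : Type _ := Fin n₁ → Fin n₂ → Fin n₃ → K

namespace Tensor3

/-- `S ≤ T` in the restriction preorder: `S` is obtained from `T` by applying matrices
`A`, `B`, `C` to the three legs of `T`. -/
def Restricts {K : Type*} [Field K] {n₁ n₂ n₃ m₁ m₂ m₃ : ℕ}
    (S : Tensor3 K n₁ n₂ n₃) (T : Tensor3 K m₁ m₂ m₃) : Prop :=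
  ∃ (A : Matrix (Fin n₁) (Fin m₁) K) (B : Matrix (Fin n₂) (Fin m₂) K)
    (C : Matrix (Fin n₃) (Fin m₃) K),
    ∀ i j k, S i j k = ∑ a, ∑ b, ∑ c, A i a * B j b * C k c * T a b c

/-- The diagonal tensor `I_r ∈ K^{r,r,r}`. -/
def unit (K : Type*) [Field K] (r : ℕ) : Tensor3 K r r r :=
  fun i j k => if i = j ∧ j = k then 1 else 0

/-- The subrank `Q(T)`: the largest `r` with `I_r ≤ T` (a maximum by `subrank_isGreatest`). -/
noncomputable def subrank {K : Type*} [Field K] {n₁ n₂ n₃ : ℕ} (T : Tensor3 K n₁ n₂ n₃) : ℕ :=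
  sSup {r : ℕ | Restricts (unit K r) T}

/-- Zariski-open sets of tensors: the complement is the common zero set of finitely many
polynomials in the entries. -/
def IsZariskiOpen {K : Type*} [Field K] {n₁ n₂ n₃ : ℕ} (U : Set (Tensor3 K n₁ n₂ n₃)) : Prop :=
  ∃ F : Finset (MvPolynomial (Fin n₁ × Fin n₂ × Fin n₃) K),
    Uᶜ = {T | ∀ p ∈ F, MvPolynomial.eval (fun x => T x.1 x.2.1 x.2.2) p = 0}

/-- `r` is the value of the subrank on some nonempty Zariski-open subset of `K^{n₁,n₂,n₃}`. -/
def IsGenericSubrank (K : Type*) [Field K] (n₁ n₂ n₃ r : ℕ) : Prop :=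
  ∃ U : Set (Tensor3 K n₁ n₂ n₃), U.Nonempty ∧ IsZariskiOpen U ∧ ∀ T ∈ U, subrank T = r

/-- The generic subrank `Q(n₁,n₂,n₃)`. Over an infinite field at most one `r` satisfies
`IsGenericSubrank` (see `IsGenericSubrank.unique`); if there is one, this is it. -/
noncomputable def genericSubrank (K : Type*) [Field K] (n₁ n₂ n₃ : ℕ) : ℕ :=
  sSup {r : ℕ | IsGenericSubrank K n₁ n₂ n₃ r}

theorem Restricts.unit_le {K : Type*} [Field K] {n₁ n₂ n₃ r : ℕ} {T : Tensor3 K n₁ n₂ n₃}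
    (h : Restricts (unit K r) T) : r ≤ n₁ := by
  obtain ⟨A, B, C, h⟩ := h
  by_contra hlt
  have hdep : ¬ LinearIndependent K (fun i => A i) := by
    intro hl
    have := hl.fintype_card_le_finrank
    simp at this
    omega
  rw [Fintype.not_linearIndependent_iff] at hdep
  obtain ⟨v, hv, j, hj⟩ := hdep
  apply hj
  have h1 : ∑ i, v i * unit K r i j j = v j := by
    simp [unit]
  rw [← h1]
  have h2 : ∀ a, ∑ i, v i * A i a = 0 := fun a => by
    simpa using congrFun hv a
  calc ∑ i, v i * unit K r i j j
      = ∑ i, ∑ a, (v i * A i a) * ∑ b, ∑ c, B j b * C j c * T a b c := by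
        refine Finset.sum_congr rfl fun i _ => ?_
        rw [h, Finset.mul_sum]
        refine Finset.sum_congr rfl fun a _ => ?_
        simp only [Finset.mul_sum]
        refine Finset.sum_congr rfl fun b _ => Finset.sum_congr rfl fun c _ => by ring
    _ = 0 := by
        rw [Finset.sum_comm]
        refine Finset.sum_eq_zero fun a _ => ?_
        rw [← Finset.sum_mul, h2, zero_mul]

theorem subrank_isGreatest {K : Type*} [Field K] {n₁ n₂ n₃ : ℕ} (T : Tensor3 K n₁ n₂ n₃) :
    IsGreatest {r : ℕ | Restricts (unit K r) T} (subrank T) := by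
  have hb : BddAbove {r : ℕ | Restricts (unit K r) T} := ⟨n₁, fun r hr => hr.unit_le⟩
  have h0 : {r : ℕ | Restricts (unit K r) T}.Nonempty :=
    ⟨0, 0, 0, 0, fun i => i.elim0⟩
  exact ⟨Nat.sSup_mem h0 hb, fun r hr => le_csSup hb hr⟩

theorem IsZariskiOpen.inter_nonempty {K : Type*} [Field K] [Infinite K] {n₁ n₂ n₃ : ℕ}
    {U V : Set (Tensor3 K n₁ n₂ n₃)} (hU : IsZariskiOpen U) (hV : IsZariskiOpen V)
    (hU' : U.Nonempty) (hV' : V.Nonempty) : (U ∩ V).Nonempty := by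
  obtain ⟨F, hF⟩ := hU
  obtain ⟨G, hG⟩ := hV
  have memU : ∀ T, T ∈ U ↔ ∃ p ∈ F, MvPolynomial.eval (fun x => T x.1 x.2.1 x.2.2) p ≠ 0 := by
    intro T
    have := congrArg (T ∈ ·) hF
    simp only [Set.mem_compl_iff, Set.mem_ofPred_eq, eq_iff_iff] at this
    rw [← not_iff_not, this]; push Not; rfl
  have memV : ∀ T, T ∈ V ↔ ∃ p ∈ G, MvPolynomial.eval (fun x => T x.1 x.2.1 x.2.2) p ≠ 0 := by
    intro T
    have := congrArg (T ∈ ·) hG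
    simp only [Set.mem_compl_iff, Set.mem_ofPred_eq, eq_iff_iff] at this
    rw [← not_iff_not, this]; push Not; rfl
  obtain ⟨S, hS⟩ := hU'
  obtain ⟨T, hT⟩ := hV'
  obtain ⟨p, hp, hpS⟩ := (memU S).1 hS
  obtain ⟨q, hq, hqT⟩ := (memV T).1 hT
  have hp0 : p ≠ 0 := by rintro rfl; simp at hpS
  have hq0 : q ≠ 0 := by rintro rfl; simp at hqT
  have hex : ∃ x, MvPolynomial.eval x (p * q) ≠ 0 := by
    by_contra hcon
    push Not at hcon
    exact mul_ne_zero hp0 hq0 (MvPolynomial.funext fun x => by rw [hcon x, map_zero])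
  obtain ⟨x, hx⟩ := hex
  rw [map_mul] at hx
  exact ⟨fun i j k => x (i, j, k), (memU _).2 ⟨p, hp, left_ne_zero_of_mul hx⟩,
    (memV _).2 ⟨q, hq, right_ne_zero_of_mul hx⟩⟩

theorem IsGenericSubrank.unique {K : Type*} [Field K] [Infinite K] {n₁ n₂ n₃ r s : ℕ}
    (hr : IsGenericSubrank K n₁ n₂ n₃ r) (hs : IsGenericSubrank K n₁ n₂ n₃ s) : r = s := by
  obtain ⟨U, hU, hUo, hUr⟩ := hr
  obtain ⟨V, hV, hVo, hVs⟩ := hs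
  obtain ⟨T, hTU, hTV⟩ := hUo.inter_nonempty hVo hU hV
  rw [← hUr T hTU, hVs T hTV]

theorem IsGenericSubrank.genericSubrank_eq {K : Type*} [Field K] [Infinite K] {n₁ n₂ n₃ r : ℕ}
    (hr : IsGenericSubrank K n₁ n₂ n₃ r) : genericSubrank K n₁ n₂ n₃ = r := by
  have : {s : ℕ | IsGenericSubrank K n₁ n₂ n₃ s} = {r} :=
    Set.eq_singleton_iff_unique_mem.2 ⟨hr, fun s hs => IsGenericSubrank.unique hs hr⟩
  rw [genericSubrank, this, csSup_singleton]

end Tensor3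

/-! Existence. The arrays of subrank at least `r` form the projection of the variety of all `(T, A,
B, C)` with `(A, B, C) · T = I_r`. By Chevalley and the Nullstellensatz such a projection contains a
nonempty principal open set or lies in a hypersurface (`exists_ne_zero_projection_dichotomy`). The
largest `r` of the first kind is the generic subrank.

Lower bound. Let `r = 3m` and `n ≥ 3m(m+1) = r + 3m²`. Take an array `T₀` with diagonal `r × r × r`
block and matrix spaces `U₁, U₂, U₃` in the three adjacent blocks. Moving `T₀` by unipotent matrices
changes the diagonal block, to first order, by `K^r ⊗ U₁ + K^r ⊗ U₂ + K^r ⊗ U₃`, while the other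
entries are free. Explicit `Uᵢ` of dimension `3m²` make this sum everything
(`exists_decomposition`). So curves of arrays of subrank at least `r` leave `T₀` in every direction,
and no nonzero polynomial vanishes on all of them (`eq_zero_of_forall_curve`).

Upper bound. Arrays of subrank at least `r` are covered by finitely many polynomial maps in `n³ - r³
+ 3rn` parameters (`exists_eq_act_extendRows`). If `3n < r²` this is less than `n³`, so they lie in
a hypersurface. -/

open scoped Kronecker Matrix

/-! ### Projections of affine varieties -/

namespace MvPolynomial

/-- A prime lying over the maximal ideal of `x` stays proper after passing to the fibre over `x`,
where the Nullstellensatz gives a point. -/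
theorem exists_common_zero_of_isPrime {K σ τ : Type*} [Field K] [IsAlgClosed K]
    [Finite τ] (x : σ → K) (q : Ideal (MvPolynomial τ (MvPolynomial σ K))) [q.IsPrime]
    (hq : q.comap C = RingHom.ker (eval x)) :
    ∃ y : τ → K, ∀ p ∈ q, eval₂ (eval x) y p = 0 := by
  have hsurj : Function.Surjective (eval x : MvPolynomial σ K →+* K) :=
    fun z => ⟨C z, eval_C z⟩
  have hker : RingHom.ker (map (eval x) : MvPolynomial τ (MvPolynomial σ K) →+* _) ≤ q := by
    rw [ker_map, Ideal.map_le_iff_le_comap, hq]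
  have hprime := Ideal.map_isPrime_of_surjective (map_surjective _ hsurj) hker
  obtain ⟨M, hM, hle⟩ := Ideal.exists_le_maximal _ hprime.ne_top
  obtain ⟨y, rfl⟩ := eq_vanishingIdeal_singleton_of_isMaximal K hM
  refine ⟨y, fun p hp => ?_⟩
  have := hle (Ideal.mem_map_of_mem _ hp)
  rw [mem_vanishingIdeal_singleton_iff] at this
  rwa [← eval_map]

/-- The projection to the `x`-space of an affine variety `F(x, y) = 0` over an algebraically closed
field either contains a nonempty principal open set or is contained in a hypersurface. -/
theorem exists_ne_zero_projection_dichotomy {K : Type*} [Field K] [IsAlgClosed K] {σ τ ι : Type}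
    [Finite σ] [Finite τ] [Finite ι] (F : ι → MvPolynomial τ (MvPolynomial σ K)) :
    ∃ f : MvPolynomial σ K, f ≠ 0 ∧
      ((∀ x, eval x f ≠ 0 → ∃ y, ∀ i, eval₂ (eval x) y (F i) = 0) ∨
        ∀ x, (∃ y, ∀ i, eval₂ (eval x) y (F i) = 0) → eval x f = 0) := by
  have hcl : Topology.IsConstructible (PrimeSpectrum.zeroLocus (Set.range F)) := by
    rw [← Topology.isConstructible_compl]
    exact (PrimeSpectrum.isRetrocompact_zeroLocus_compl (Set.finite_range F)).isConstructible
      (PrimeSpectrum.isClosed_zeroLocus _).isOpen_compl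
  have hfp : (C : MvPolynomial σ K →+* MvPolynomial τ (MvPolynomial σ K)).FinitePresentation :=
    (RingHom.finitePresentation_algebraMap).2 inferInstance
  -- Chevalley: the image is a finite union of pieces `{g = 0, f ≠ 0}`.
  obtain ⟨S, hS⟩ := PrimeSpectrum.exists_constructibleSetData_iff.2
    (PrimeSpectrum.isConstructible_comap_image hfp hcl)
  have key : ∀ x : σ → K, (∃ y, ∀ i, eval₂ (eval x) y (F i) = 0) ↔
      ∃ D ∈ S, (∀ j, eval x (D.g j) = 0) ∧ eval x D.f ≠ 0 := by
    intro x
    have hx : (∃ y, ∀ i, eval₂ (eval x) y (F i) = 0) ↔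
        (⟨RingHom.ker (eval x), RingHom.ker_isPrime _⟩ : PrimeSpectrum (MvPolynomial σ K)) ∈
          PrimeSpectrum.comap C '' PrimeSpectrum.zeroLocus (Set.range F) := by
      constructor
      · rintro ⟨y, hy⟩
        refine ⟨⟨RingHom.ker (eval₂Hom (eval x) y), RingHom.ker_isPrime _⟩, ?_, ?_⟩
        · rintro _ ⟨i, rfl⟩
          exact hy i
        · ext p
          simp
      · rintro ⟨q, hq, hqx⟩
        have := q.isPrime
        obtain ⟨y, hy⟩ := exists_common_zero_of_isPrime x q.asIdeal
          (congrArg PrimeSpectrum.asIdeal hqx)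
        exact ⟨y, fun i => hy _ (hq ⟨i, rfl⟩)⟩
    rw [hx, ← hS]
    simp [PrimeSpectrum.ConstructibleSetData.toSet, PrimeSpectrum.BasicConstructibleSetData.toSet,
      PrimeSpectrum.mem_zeroLocus, Set.range_subset_iff, and_left_comm]
  -- A piece without equations and with `f ≠ 0` is principal open. If there is none, each piece lies
  -- in some `g j = 0` or is empty, and the product of the chosen polynomials vanishes on the union.
  by_cases h : ∃ D ∈ S, (∀ j, D.g j = 0) ∧ D.f ≠ 0
  · obtain ⟨D, hD, hg, hf⟩ := h
    exact ⟨D.f, hf, Or.inl fun x hxf => (key x).2 ⟨D, hD, by simp [hg], hxf⟩⟩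
  · push Not at h
    have hex : ∀ D : PrimeSpectrum.BasicConstructibleSetData (MvPolynomial σ K),
        ∃ p : MvPolynomial σ K, p ≠ 0 ∧
          (D ∈ S → ∀ x, (∀ j, eval x (D.g j) = 0) → eval x D.f ≠ 0 → eval x p = 0) := by
      intro D
      by_cases hg : ∃ j, D.g j ≠ 0
      · obtain ⟨j, hj⟩ := hg
        exact ⟨D.g j, hj, fun _ x hx _ => hx j⟩
      · push Not at hg
        refine ⟨1, one_ne_zero, fun hD x _ hx => ?_⟩
        rw [h D hD hg, map_zero] at hx
        exact absurd rfl hx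
    choose p hp0 hp using hex
    refine ⟨∏ D ∈ S, p D, Finset.prod_ne_zero_iff.2 fun D _ => hp0 D, Or.inr fun x hx => ?_⟩
    obtain ⟨D, hD, hg, hf⟩ := (key x).1 hx
    rw [map_prod]
    exact Finset.prod_eq_zero hD (hp D hD x hg hf)

end MvPolynomial

/-! ### Polynomials vanishing on curves -/

namespace MvPolynomial

theorem aeval_mul_left_of_isHomogeneous {σ K A : Type*} [CommSemiring K] [CommSemiring A] [Algebra K A]
    {p : MvPolynomial σ K} {d : ℕ} (hp : p.IsHomogeneous d) (a : A) (q : σ → A) :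
    aeval (fun i => a * q i) p = a ^ d * aeval q p := by
  rw [aeval_def, aeval_def, eval₂_eq, eval₂_eq, Finset.mul_sum]
  refine Finset.sum_congr rfl fun m hm => ?_
  have hd : ∑ i ∈ m.support, m i = d := by
    have := hp (mem_support_iff.1 hm)
    simpa [Finsupp.weight_apply, Finsupp.sum] using this
  simp only [mul_pow, Finset.prod_mul_distrib]
  rw [Finset.prod_pow_eq_pow_sum, hd]
  ring

theorem eval_aeval_polynomial {σ K : Type*} [CommSemiring K] (c : σ → Polynomial K)
    (p : MvPolynomial σ K) (t : K) :
    (aeval c p).eval t = eval (fun i => (c i).eval t) p := by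
  rw [← Polynomial.coe_evalRingHom, map_aeval]
  have hid : (Polynomial.evalRingHom t).comp (algebraMap K (Polynomial K)) = RingHom.id K := by
    ext; simp
  rw [hid]
  rfl

/-- If the components of `p` below degree `d` vanish, the coefficient of `t ^ d` in `p (t * q t)` is
the degree `d` component at `q 0 = w`. So the components vanish one after another. -/
theorem eq_zero_of_forall_curve_through_zero {σ K : Type*} [Field K] [Infinite K]
    (p : MvPolynomial σ K)
    (h : ∀ w : σ → K, ∃ q : σ → Polynomial K, (∀ i, (q i).coeff 0 = w i) ∧
      ∀ t : K, eval (fun i => t * (q i).eval t) p = 0) : p = 0 := by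
  have hcomp : ∀ d, homogeneousComponent d p = 0 := by
    intro d
    induction d using Nat.strong_induction_on with
    | _ d ih =>
      refine MvPolynomial.funext fun w => ?_
      obtain ⟨q, hq, hz⟩ := h w
      have h0 : aeval (fun i => Polynomial.X * q i) p = 0 := by
        refine Polynomial.funext fun t => ?_
        rw [eval_aeval_polynomial, Polynomial.eval_zero, ← hz t]
        simp only [Polynomial.eval_mul, Polynomial.eval_X]
      rw [← sum_homogeneousComponent p, map_sum] at h0
      have hterm : ∀ e, aeval (fun i => Polynomial.X * q i) (homogeneousComponent e p) =
          Polynomial.X ^ e * aeval q (homogeneousComponent e p) := fun e =>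
        aeval_mul_left_of_isHomogeneous (homogeneousComponent_isHomogeneous e p) _ _
      have hc := congrArg (fun f => Polynomial.coeff f d) h0
      simp only [hterm, Polynomial.finsetSum_coeff, Polynomial.coeff_zero] at hc
      have hval : (aeval q (homogeneousComponent d p)).coeff 0 =
          eval w (homogeneousComponent d p) := by
        simp only [Polynomial.coeff_zero_eq_eval_zero] at hq ⊢
        rw [eval_aeval_polynomial, _root_.funext hq]
      rw [map_zero, ← hval]
      by_cases hd : d < p.totalDegree + 1
      · rw [Finset.sum_eq_single_of_mem d (Finset.mem_range.2 hd)] at hc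
        · rw [← hc, Polynomial.coeff_X_pow_mul', if_pos le_rfl, Nat.sub_self]
        · intro e _ hed
          rcases lt_or_gt_of_ne hed with hlt | hgt
          · rw [ih e hlt, map_zero, mul_zero, Polynomial.coeff_zero]
          · rw [Polynomial.coeff_X_pow_mul', if_neg (by omega)]
      · rw [homogeneousComponent_eq_zero _ _ (by omega), map_zero, Polynomial.coeff_zero]
  rw [← sum_homogeneousComponent p]
  exact Finset.sum_eq_zero fun d _ => hcomp d

/-- A polynomial vanishing on curves through `w₀` in every tangent direction is zero. -/
theorem eq_zero_of_forall_curve {σ K : Type*} [Field K] [Infinite K]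
    (p : MvPolynomial σ K) (w₀ : σ → K)
    (h : ∀ w : σ → K, ∃ c : σ → Polynomial K, (∀ i, (c i).coeff 0 = w₀ i) ∧
      (∀ i, (c i).coeff 1 = w i) ∧ ∀ t : K, eval (fun i => (c i).eval t) p = 0) : p = 0 := by
  have hev : ∀ x : σ → K, eval x (aeval (fun i => X i + C (w₀ i)) p) =
      eval (fun i => x i + w₀ i) p := by
    intro x
    rw [map_aeval]
    have hid : (eval x).comp (algebraMap K (MvPolynomial σ K)) = RingHom.id K := by ext; simp
    simp only [hid, map_add, eval_X, eval_C]
    rfl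
  have hp : aeval (fun i => X i + C (w₀ i)) p = 0 := by
    refine eq_zero_of_forall_curve_through_zero _ fun w => ?_
    obtain ⟨c, hc0, hc1, hc⟩ := h w
    refine ⟨fun i => (c i).divX, fun i => by rw [Polynomial.coeff_divX, hc1], fun t => ?_⟩
    rw [hev, ← hc t]
    congr 2
    funext i
    conv_rhs => rw [← Polynomial.divX_mul_X_add (c i)]
    simp [hc0, mul_comm]
  refine MvPolynomial.funext fun x => ?_
  have := hev (fun i => x i - w₀ i)
  rw [hp, map_zero] at this
  simpa using this.symm

end MvPolynomial

/-! ### Matrix spaces generating all cubic arrays -/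

namespace Tensor3

/-- Explicit `3`-dimensional spaces `U₁, U₂, U₃` of `3 × 3` matrices with
`K³ ⊗ K³ ⊗ K³ = K³ ⊗ U₁ + K³ ⊗ U₂ + K³ ⊗ U₃`, each `Uᵢ` living on the two other legs. -/
theorem exists_decomposition_three (K : Type*) [CommRing K] :
    ∃ U₁ U₂ U₃ : Fin 3 → Fin 3 → Fin 3 → K, ∀ y : Fin 3 → Fin 3 → Fin 3 → K,
      ∃ a b c : Fin 3 → Fin 3 → K, ∀ i j k,
        ∑ s, a i s * U₁ s j k + ∑ s, b j s * U₂ s i k + ∑ s, c k s * U₃ s i j = y i j k := by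
  -- The unknowns `a`, `b`, `c` have `27` entries, as many as `y`. The formulas in `y` solve this
  -- system with integer coefficients, hence in every characteristic.
  refine ⟨![![![0, 0, 0], ![0, 1, 0], ![0, 0, 1]], ![![0, 0, 0], ![0, 0, 1], ![0, 0, 0]],
      ![![0, 0, 0], ![1, 0, 0], ![0, 1, 0]]],
    ![![![0, 1, 0], ![0, 0, 0], ![0, 0, 0]], ![![1, 0, 0], ![0, 1, 0], ![0, 0, 0]],
      ![![0, 0, 1], ![1, 0, 0], ![0, 0, 0]]],
    ![![![1, 0, 0], ![1, 0, 0], ![0, 0, 0]], ![![0, 0, 0], ![0, 0, 0], ![0, 0, 1]],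
      ![![0, 0, 0], ![0, 0, 0], ![1, 0, 0]]], fun y => ⟨
    ![![y 0 2 2 - y 1 2 0, y 0 1 2 - y 0 2 0 - y 1 1 0 + y 1 2 1, y 0 1 0 - y 1 1 1 + y 1 2 2],
      ![y 1 2 2, y 1 1 2, -y 0 2 0 + y 1 2 1],
      ![y 2 1 1, y 2 1 2, y 2 1 0]],
    ![![y 0 0 0 + y 0 0 1 + y 0 0 2 - y 1 0 0 - y 1 0 1 - y 1 0 2,
        y 0 0 0 + y 0 0 2 - y 1 0 0 - y 1 0 2, y 0 0 2 - y 1 0 2],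
      ![y 0 1 1 - y 0 2 2 + y 1 2 0, y 1 1 1 - y 1 2 2, y 0 2 0 + y 1 1 0 - y 1 2 1],
      ![-y 0 1 0 + y 0 2 1 + y 1 1 1 - y 1 2 2, y 0 2 0, y 1 2 0]],
    ![![-y 0 0 2 + y 1 0 0 + y 1 0 2, y 2 2 0, y 2 0 0],
      ![-y 0 0 0 - y 0 0 2 + y 1 0 0 + y 1 0 1 + y 1 0 2, -y 2 1 0 + y 2 2 1, y 2 0 1],
      ![y 1 0 2, -y 2 1 1 + y 2 2 2, y 2 0 2]], ?_⟩⟩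
  intro i j k
  fin_cases i <;> fin_cases j <;> fin_cases k <;> simp [Fin.sum_univ_three]
  ring

/-- Cut `y` into `m³` blocks of size `3 × 3 × 3` and solve in each. A copy of the three matrices for
every pair of block positions keeps the blocks independent and costs `3m²` matrices per leg. The
summand `Fin d` is zero padding that lets `n` exceed `3m(m+1)`. -/
theorem exists_decomposition (K : Type*) [CommRing K] (m d : ℕ) :
    ∃ U₁ U₂ U₃ : (Fin 3 × Fin m × Fin m) ⊕ Fin d → Fin 3 × Fin m → Fin 3 × Fin m → K,
      ∀ y : Fin 3 × Fin m → Fin 3 × Fin m → Fin 3 × Fin m → K,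
      ∃ a b c : Fin 3 × Fin m → (Fin 3 × Fin m × Fin m) ⊕ Fin d → K, ∀ i j k,
        ∑ s, a i s * U₁ s j k + ∑ s, b j s * U₂ s i k + ∑ s, c k s * U₃ s i j = y i j k := by
  obtain ⟨U₁, U₂, U₃, h⟩ := exists_decomposition_three K
  choose a b c habc using h
  let V (U : Fin 3 → Fin 3 → Fin 3 → K) :
      (Fin 3 × Fin m × Fin m) ⊕ Fin d → Fin 3 × Fin m → Fin 3 × Fin m → K := fun s j k =>
    Sum.elim (fun s => if s.2.1 = j.2 ∧ s.2.2 = k.2 then U s.1 j.1 k.1 else 0) 0 s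
  refine ⟨V U₁, V U₂, V U₃, fun y => ?_⟩
  let z (p q r : Fin m) : Fin 3 → Fin 3 → Fin 3 → K := fun i j k => y (i, p) (j, q) (k, r)
  refine ⟨fun i => Sum.elim (fun s => a (z i.2 s.2.1 s.2.2) i.1 s.1) 0,
    fun j => Sum.elim (fun s => b (z s.2.1 j.2 s.2.2) j.1 s.1) 0,
    fun k => Sum.elim (fun s => c (z s.2.1 s.2.2 k.2) k.1 s.1) 0, ?_⟩
  rintro ⟨i, p⟩ ⟨j, q⟩ ⟨k, r⟩
  have := habc (z p q r) i j k
  simpa [V, Fintype.sum_prod_type, ite_and, z] using this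

/-! ### The action of matrix triples and its first-order expansion -/

/-- The action of a triple of matrices on the three legs of an array. -/
def act {R α β γ α' β' γ' : Type*} [CommSemiring R] [Fintype α] [Fintype β] [Fintype γ]
    (A : Matrix α' α R) (B : Matrix β' β R) (C : Matrix γ' γ R) (T : α × β × γ → R) :
    α' × β' × γ' → R :=
  (A ⊗ₖ (B ⊗ₖ C)) *ᵥ T

section act

variable {R α β γ α' β' γ' α'' β'' γ'' : Type*} [CommSemiring R]
  [Fintype α] [Fintype β] [Fintype γ]

theorem act_apply (A : Matrix α' α R) (B : Matrix β' β R) (C : Matrix γ' γ R)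
    (T : α × β × γ → R) (i : α') (j : β') (k : γ') :
    act A B C T (i, j, k) = ∑ a, ∑ b, ∑ c, A i a * B j b * C k c * T (a, b, c) := by
  simp [act, Matrix.mulVec, dotProduct, Fintype.sum_prod_type, mul_assoc]

theorem act_act [Fintype α'] [Fintype β'] [Fintype γ']
    (A' : Matrix α'' α' R) (B' : Matrix β'' β' R) (C' : Matrix γ'' γ' R)
    (A : Matrix α' α R) (B : Matrix β' β R) (C : Matrix γ' γ R) (T : α × β × γ → R) :
    act A' B' C' (act A B C T) = act (A' * A) (B' * B) (C' * C) T := by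
  simp only [act, Matrix.mulVec_mulVec, ← Matrix.mul_kronecker_mul]

theorem act_one [DecidableEq α] [DecidableEq β] [DecidableEq γ] (T : α × β × γ → R) :
    act 1 1 1 T = T := by
  simp [act]

theorem act_submatrix (A : Matrix α' α R) (B : Matrix β' β R) (C : Matrix γ' γ R)
    (T : α × β × γ → R) (e : α'' → α') (f : β'' → β') (g : γ'' → γ') (i : α'') (j : β'') (k : γ'') :
    act (A.submatrix e id) (B.submatrix f id) (C.submatrix g id) T (i, j, k) =
      act A B C T (e i, f j, g k) := by
  simp [act_apply]

theorem act_comp_equiv [Fintype α'] [Fintype β'] [Fintype γ']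
    (A : Matrix α'' α R) (B : Matrix β'' β R) (C : Matrix γ'' γ R)
    (T : α × β × γ → R) (e : α' ≃ α) (f : β' ≃ β) (g : γ' ≃ γ) :
    act (A.submatrix id e) (B.submatrix id f) (C.submatrix id g)
      (fun x => T (e x.1, f x.2.1, g x.2.2)) = act A B C T := by
  funext ⟨i, j, k⟩
  simp only [act_apply, Matrix.submatrix_apply, id]
  rw [← e.sum_comp]
  refine Finset.sum_congr rfl fun a _ => ?_
  rw [← f.sum_comp]
  refine Finset.sum_congr rfl fun b _ => ?_
  rw [← g.sum_comp]

end act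

theorem restricts_unit_iff {K : Type*} [Field K] {n₁ n₂ n₃ r : ℕ} {T : Tensor3 K n₁ n₂ n₃} :
    Restricts (unit K r) T ↔ ∃ (A : Matrix (Fin r) (Fin n₁) K) (B : Matrix (Fin r) (Fin n₂) K)
      (C : Matrix (Fin r) (Fin n₃) K), ∀ i j k,
        act A B C (fun x => T x.1 x.2.1 x.2.2) (i, j, k) = if i = j ∧ j = k then 1 else 0 := by
  simp only [Restricts, unit, act_apply, eq_comm]

section Perturbation

open Polynomial

variable {K ι κ μ : Type*} [CommRing K] [DecidableEq ι] [DecidableEq κ] [DecidableEq μ]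

/-- The matrix `1 + X N` over the polynomial ring. -/
noncomputable def perturbedOne (N : Matrix ι ι K) : Matrix ι ι K[X] :=
  fun i u => C ((1 : Matrix ι ι K) i u) + X * C (N i u)

theorem coeff_zero_perturbedOne (N : Matrix ι ι K) (i u : ι) :
    (perturbedOne N i u).coeff 0 = if i = u then 1 else 0 := by
  simp only [perturbedOne, Matrix.one_apply]
  split_ifs <;> simp

theorem coeff_one_perturbedOne (N : Matrix ι ι K) (i u : ι) :
    (perturbedOne N i u).coeff 1 = N i u := by
  simp [perturbedOne, coeff_C]

theorem eval_perturbedOne (N : Matrix ι ι K) (t : K) (i u : ι) :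
    (perturbedOne N i u).eval t = (1 + t • N) i u := by
  simp [perturbedOne]
  ring

variable [Fintype ι] [Fintype κ] [Fintype μ] (N₁ : Matrix ι ι K) (N₂ : Matrix κ κ K)
  (N₃ : Matrix μ μ K) (T D : ι × κ × μ → K)

theorem coeff_zero_act_perturbedOne (x : ι × κ × μ) :
    (act (perturbedOne N₁) (perturbedOne N₂) (perturbedOne N₃)
      (fun x => C (T x) + X * C (D x)) x).coeff 0 = T x := by
  obtain ⟨i, j, k⟩ := x
  simp only [act_apply, finsetSum_coeff, mul_coeff_zero, coeff_zero_perturbedOne]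
  simp

/-- The Leibniz rule: the velocity is `D` plus the infinitesimal action on each leg. -/
theorem coeff_one_act_perturbedOne (i : ι) (j : κ) (k : μ) :
    (act (perturbedOne N₁) (perturbedOne N₂) (perturbedOne N₃)
      (fun x => C (T x) + X * C (D x)) (i, j, k)).coeff 1 =
      D (i, j, k) + ∑ u, N₁ i u * T (u, j, k) + ∑ u, N₂ j u * T (i, u, k) +
        ∑ u, N₃ k u * T (i, j, u) := by
  simp only [act_apply, finsetSum_coeff, mul_coeff_one, mul_coeff_zero, coeff_zero_perturbedOne,
    coeff_one_perturbedOne, coeff_add, coeff_C_zero, coeff_X_zero, coeff_X_one, coeff_C_succ,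
    add_mul, Finset.sum_add_distrib]
  simp
  ring

theorem eval_act_perturbedOne (t : K) :
    (fun x => (act (perturbedOne N₁) (perturbedOne N₂) (perturbedOne N₃)
      (fun x => C (T x) + X * C (D x)) x).eval t) =
      act (1 + t • N₁) (1 + t • N₂) (1 + t • N₃) (fun x => T x + t * D x) := by
  funext ⟨i, j, k⟩
  simp only [act_apply, eval_finsetSum, eval_mul, eval_add, eval_C, eval_X, eval_perturbedOne]

end Perturbation

/-! ### Density of arrays restricting to a unit tensor -/

section Density

variable {K ρ σ : Type*} [Field K] [Fintype ρ] [Fintype σ]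

/-- The array whose `ρ × ρ × ρ` block is diagonal, and whose three adjacent blocks are given. -/
def borderedUnit [DecidableEq ρ] (U₁ U₂ U₃ : σ → ρ → ρ → K) : (ρ ⊕ σ) × (ρ ⊕ σ) × (ρ ⊕ σ) → K
  | (.inl i, .inl j, .inl k) => if i = j ∧ j = k then 1 else 0
  | (.inr s, .inl j, .inl k) => U₁ s j k
  | (.inl i, .inr s, .inl k) => U₂ s i k
  | (.inl i, .inl j, .inr s) => U₃ s i j
  | _ => 0

/-- The strictly block upper triangular matrix with upper right block `a`. -/
def upperBlock (a : Matrix ρ σ K) : Matrix (ρ ⊕ σ) (ρ ⊕ σ) K :=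
  Matrix.fromBlocks 0 a 0 0

theorem sum_upperBlock_inl (a : Matrix ρ σ K) (i : ρ) (f : ρ ⊕ σ → K) :
    ∑ u, upperBlock a (Sum.inl i) u * f u = ∑ s, a i s * f (Sum.inr s) := by
  rw [Fintype.sum_sum_type]
  simp [upperBlock]

theorem one_sub_mul_one_add_upperBlock [DecidableEq ρ] [DecidableEq σ]
    (a : Matrix ρ σ K) (t : K) :
    (1 - t • upperBlock a) * (1 + t • upperBlock a) = 1 := by
  have h : upperBlock a * upperBlock a = 0 := by
    simp [upperBlock, Matrix.fromBlocks_multiply]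
  simp [sub_mul, mul_add, h]

/-- The arrays that restrict to a unit tensor are not contained in a hypersurface, provided that
the matrix spaces `Uᵢ` generate all arrays of size `ρ × ρ × ρ`. -/
theorem eq_zero_of_forall_act_eq_unit [Infinite K] [DecidableEq ρ] [DecidableEq σ]
    (U₁ U₂ U₃ : σ → ρ → ρ → K)
    (hU : ∀ y : ρ → ρ → ρ → K, ∃ a b c : ρ → σ → K, ∀ i j k,
        ∑ s, a i s * U₁ s j k + ∑ s, b j s * U₂ s i k + ∑ s, c k s * U₃ s i j = y i j k)
    (p : MvPolynomial ((ρ ⊕ σ) × (ρ ⊕ σ) × (ρ ⊕ σ)) K)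
    (hp : ∀ T : (ρ ⊕ σ) × (ρ ⊕ σ) × (ρ ⊕ σ) → K,
      (∃ A B C : Matrix ρ (ρ ⊕ σ) K,
        ∀ i j k, act A B C T (i, j, k) = if i = j ∧ j = k then 1 else 0) →
      MvPolynomial.eval T p = 0) : p = 0 := by
  refine MvPolynomial.eq_zero_of_forall_curve p (borderedUnit U₁ U₂ U₃) fun w => ?_
  obtain ⟨a, b, c, habc⟩ : ∃ a b c : Matrix ρ σ K, ∀ i j k,
      ∑ s, a i s * U₁ s j k + ∑ s, b j s * U₂ s i k + ∑ s, c k s * U₃ s i j =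
        w (.inl i, .inl j, .inl k) := hU fun i j k => w (.inl i, .inl j, .inl k)
  let T₀ := borderedUnit U₁ U₂ U₃
  -- Chosen so that the curve has velocity `w`. By the choice of `a`, `b`, `c` it vanishes on the
  -- diagonal block, so `T₀ + t D` keeps that block for every `t`.
  let D (x : (ρ ⊕ σ) × (ρ ⊕ σ) × (ρ ⊕ σ)) : K :=
    w x - ∑ u, upperBlock a x.1 u * T₀ (u, x.2.1, x.2.2) -
      ∑ u, upperBlock b x.2.1 u * T₀ (x.1, u, x.2.2) -
      ∑ u, upperBlock c x.2.2 u * T₀ (x.1, x.2.1, u)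
  have hD : ∀ i j k, D (.inl i, .inl j, .inl k) = 0 := by
    intro i j k
    simp only [D, sum_upperBlock_inl, ← habc i j k, T₀, borderedUnit]
    ring
  refine ⟨act (perturbedOne (upperBlock a)) (perturbedOne (upperBlock b))
    (perturbedOne (upperBlock c)) fun x => Polynomial.C (T₀ x) + Polynomial.X * Polynomial.C (D x),
    coeff_zero_act_perturbedOne _ _ _ _ _, ?_, ?_⟩
  · rintro ⟨i, j, k⟩
    rw [coeff_one_act_perturbedOne]
    simp only [D]
    ring
  · intro t
    -- As `upperBlock` squares to zero, `1 - t N` undoes `1 + t N` for all `t`; its first rows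
    -- recover the diagonal block.
    refine hp _ ⟨(1 - t • upperBlock a).submatrix Sum.inl id,
      (1 - t • upperBlock b).submatrix Sum.inl id,
      (1 - t • upperBlock c).submatrix Sum.inl id, fun i j k => ?_⟩
    rw [eval_act_perturbedOne, act_submatrix, act_act, one_sub_mul_one_add_upperBlock,
      one_sub_mul_one_add_upperBlock, one_sub_mul_one_add_upperBlock, act_one, hD]
    simp [T₀, borderedUnit]

end Density

theorem eq_zero_of_forall_restricts_unit {K : Type*} [Field K] [Infinite K] {m n : ℕ}
    (hmn : 3 * m * (m + 1) ≤ n) (p : MvPolynomial (Fin n × Fin n × Fin n) K)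
    (hp : ∀ T : Tensor3 K n n n, Restricts (unit K (3 * m)) T →
      MvPolynomial.eval (fun x => T x.1 x.2.1 x.2.2) p = 0) : p = 0 := by
  obtain ⟨d, rfl⟩ := Nat.exists_eq_add_of_le hmn
  obtain ⟨U₁, U₂, U₃, hU⟩ := exists_decomposition K m d
  have e : (Fin 3 × Fin m) ⊕ ((Fin 3 × Fin m × Fin m) ⊕ Fin d) ≃ Fin (3 * m * (m + 1) + d) :=
    Fintype.equivFinOfCardEq (by simp; ring)
  have f : Fin (3 * m) ≃ Fin 3 × Fin m := finProdFinEquiv.symm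
  let E := e.prodCongr (e.prodCongr e)
  have hE : MvPolynomial.rename E.symm p = 0 := by
    refine eq_zero_of_forall_act_eq_unit U₁ U₂ U₃ hU _ fun T ⟨A, B, C, h⟩ => ?_
    rw [MvPolynomial.eval_rename]
    refine hp (fun i j k => T (e.symm i, e.symm j, e.symm k)) (restricts_unit_iff.2
      ⟨A.submatrix f e.symm, B.submatrix f e.symm, C.submatrix f e.symm, fun i j k => ?_⟩)
    have h1 := act_comp_equiv (A.submatrix f id) (B.submatrix f id) (C.submatrix f id) T
      e.symm e.symm e.symm
    simp only [Matrix.submatrix_submatrix, Function.comp_id, Function.id_comp] at h1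
    rw [h1, act_submatrix, h]
    simp
  exact MvPolynomial.rename_injective _ E.symm.injective (hE.trans (map_zero _).symm)

end Tensor3

/-- By transcendence degree, more polynomials than variables are algebraically dependent; a relation
vanishes on the image. -/
theorem MvPolynomial.exists_ne_zero_of_card_lt {K σ τ : Type*} [Field K] [Fintype σ] [Fintype τ]
    (h : Fintype.card τ < Fintype.card σ) (c : σ → MvPolynomial τ K) :
    ∃ p : MvPolynomial σ K, p ≠ 0 ∧ ∀ y : τ → K, eval (fun i => eval y (c i)) p = 0 := by
  have hdep : ¬ AlgebraicIndependent K c := by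
    intro hc
    have := hc.lift_cardinalMk_le_trdeg
    simp at this
    omega
  rw [algebraicIndependent_iff] at hdep
  push Not at hdep
  obtain ⟨p, hp, hp0⟩ := hdep
  refine ⟨p, hp0, fun y => ?_⟩
  have := congrArg (eval y) hp
  rw [map_zero, map_aeval] at this
  have hid : (eval y).comp (algebraMap K (MvPolynomial τ K)) = RingHom.id K := by ext; simp
  rw [hid] at this
  exact this

/-! ### Completion to an invertible matrix -/

namespace Matrix

/-- The square matrix whose rows indexed by the range of `e` are those of `A`, the other rows being
those of the identity matrix. -/
noncomputable def extendRows {R ι κ : Type*} [Zero R] [One R] [DecidableEq ι] (e : κ ↪ ι)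
    (A : Matrix κ ι R) : Matrix ι ι R :=
  Function.extend e A (1 : Matrix ι ι R)

section extendRows

variable {R S ι κ : Type*} [DecidableEq ι] (e : κ ↪ ι)

theorem extendRows_apply [Zero R] [One R] (A : Matrix κ ι R) (i : κ) :
    extendRows e A (e i) = A i :=
  e.injective.extend_apply _ _ _

theorem extendRows_of_forall_ne [Zero R] [One R] (A : Matrix κ ι R) {u : ι} (hu : ∀ i, e i ≠ u) :
    extendRows e A u = (1 : Matrix ι ι R) u :=
  Function.extend_apply' (f := e) A (1 : Matrix ι ι R) u (by rintro ⟨i, hi⟩; exact hu i hi)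

theorem extendRows_map [Semiring R] [Semiring S] (φ : R →+* S) (A : Matrix κ ι R) :
    (extendRows e A).map φ = extendRows e (A.map φ) := by
  ext u w
  rw [map_apply]
  by_cases hu : ∃ i, e i = u
  · obtain ⟨i, rfl⟩ := hu
    rw [extendRows_apply, extendRows_apply, map_apply]
  · push Not at hu
    rw [extendRows_of_forall_ne e A hu, extendRows_of_forall_ne e _ hu]
    by_cases huw : u = w <;> simp [one_apply, huw]

end extendRows

/-- A matrix with linearly independent rows can be completed by standard basis vectors to an
invertible matrix; the inverse has the same shape. -/
theorem exists_extendRows_mul_extendRows_eq_one {K ι : Type*} [Field K] [Fintype ι] [DecidableEq ι]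
    {r : ℕ} (A : Matrix (Fin r) ι K) (hA : LinearIndependent K A.row) :
    ∃ (e : Fin r ↪ ι) (x : Matrix (Fin r) ι K),
      extendRows e x * extendRows e A = 1 := by
  -- Select columns of `A` forming a basis of `K^r`; their positions are where the rows of `A` go.
  obtain ⟨κ, a, ha, hspan, hli⟩ := exists_linearIndependent' K A.col
  have htop : Submodule.span K (Set.range A.col) = ⊤ := by
    apply Submodule.eq_top_of_finrank_eq
    rw [← rank_eq_finrank_span_cols, hA.rank_matrix]
    simp
  let b := Module.Basis.mk hli (by rw [hspan, htop])
  let E : Fin r ≃ κ := (Pi.basisFun K (Fin r)).indexEquiv b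
  let e : Fin r ↪ ι := ⟨a ∘ E, ha.comp E.injective⟩
  have hli' : LinearIndependent K (fun i => A.col (e i)) :=
    hli.comp E E.injective
  let M : Matrix ι ι K := extendRows e A
  have hM : ∀ i, M (e i) = A i := extendRows_apply e A
  have hM' : ∀ u, (∀ i, e i ≠ u) → M u = (1 : Matrix ι ι K) u := fun u hu =>
    extendRows_of_forall_ne e A hu
  have hdet : IsUnit M.det := by
    rw [isUnit_iff_ne_zero]
    intro h0
    obtain ⟨v, hv0, hv⟩ := exists_mulVec_eq_zero_iff.2 h0
    have hout : ∀ u, (∀ i, e i ≠ u) → v u = 0 := by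
      intro u hu
      have := congrFun hv u
      rw [mulVec, hM' u hu] at this
      simpa [dotProduct, one_apply] using this
    have hin : ∀ i, v (e i) = 0 := by
      refine Fintype.linearIndependent_iff.1 hli' (fun i => v (e i)) ?_
      funext i
      have := congrFun hv (e i)
      rw [mulVec, hM, dotProduct, ← Finset.sum_subset (Finset.subset_univ (Finset.univ.map e))] at this
      · simpa [mul_comm] using this
      · intro u _ hu
        rw [hout u (by simpa using hu), mul_zero]
    refine hv0 (funext fun u => ?_)
    by_cases hu : ∃ i, e i = u
    · obtain ⟨i, rfl⟩ := hu
      exact hin i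
    · exact hout u (by simpa using hu)
  refine ⟨e, M⁻¹.submatrix e id, ?_⟩
  have hX : extendRows e (M⁻¹.submatrix e id) = M⁻¹ := by
    funext u
    by_cases hu : ∃ i, e i = u
    · obtain ⟨i, rfl⟩ := hu
      exact extendRows_apply e _ i
    · push Not at hu
      rw [extendRows_of_forall_ne e _ hu]
      -- Row `u` of `M` is a basis vector, so row `u` of `M * M⁻¹ = 1` is row `u` of `M⁻¹`.
      have h1 := congrFun (M.mul_nonsing_inv hdet) u
      rw [← h1]
      funext w
      rw [mul_apply]
      simp [hM' u hu, one_apply]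
  rw [hX]
  exact M.nonsing_inv_mul hdet

end Matrix

/-! ### Dimension count for the upper bound -/

namespace Tensor3

theorem map_act {R S α β γ α' β' γ' : Type*} [CommSemiring R] [CommSemiring S]
    [Fintype α] [Fintype β] [Fintype γ] (φ : R →+* S)
    (A : Matrix α' α R) (B : Matrix β' β R) (C : Matrix γ' γ R) (T : α × β × γ → R)
    (x : α' × β' × γ') :
    φ (act A B C T x) = act (A.map φ) (B.map φ) (C.map φ) (fun x => φ (T x)) x := by
  obtain ⟨i, j, k⟩ := x
  simp [act_apply]

section Parametrization

variable {K : Type*} [Field K] {ι : Type*} [Fintype ι] {r : ℕ}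

/-- A relation `v` among the rows on one leg contracts the unit tensor to zero on that leg, and the
entry at `(i, i)` of this contraction is `v i`. -/
theorem linearIndependent_rows_of_act_eq_unit {A B C : Matrix (Fin r) ι K} {T : ι × ι × ι → K}
    (h : ∀ i j k, act A B C T (i, j, k) = if i = j ∧ j = k then 1 else 0) :
    LinearIndependent K A.row ∧ LinearIndependent K B.row ∧ LinearIndependent K C.row := by
  classical
  have hzero : ∀ (A : Matrix (Fin r) ι K),
      (∀ v : Fin r → K, Matrix.replicateRow Unit v * A = 0 → v = 0) →
        LinearIndependent K A.row := by
    intro A hA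
    rw [Fintype.linearIndependent_iff]
    refine fun v hv => congrFun (hA v ?_)
    ext _ u
    simpa [Matrix.mul_apply] using congrFun hv u
  refine ⟨hzero A fun v hv => funext fun i => ?_, hzero B fun v hv => funext fun i => ?_,
    hzero C fun v hv => funext fun i => ?_⟩
  · have := congrFun (act_act (Matrix.replicateRow Unit v) 1 1 A B C T) ((), i, i)
    rw [hv, act_apply] at this
    simpa [h, Matrix.one_apply, act_apply, ite_and] using this
  · have := congrFun (act_act 1 (Matrix.replicateRow Unit v) 1 A B C T) (i, (), i)
    rw [hv, act_apply] at this
    simpa [h, Matrix.one_apply, act_apply, ite_and] using this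
  · have := congrFun (act_act 1 1 (Matrix.replicateRow Unit v) A B C T) (i, i, ())
    rw [hv, act_apply] at this
    simpa [h, Matrix.one_apply, act_apply, ite_and] using this

/-- Every array that restricts to the unit tensor is the image, under matrices that differ from the
identity in `r` rows only, of an array with a diagonal block. -/
theorem exists_eq_act_extendRows [DecidableEq ι] {A B C : Matrix (Fin r) ι K} {T : ι × ι × ι → K}
    (h : ∀ i j k, act A B C T (i, j, k) = if i = j ∧ j = k then 1 else 0) :
    ∃ (e f g : Fin r ↪ ι) (x y z : Matrix (Fin r) ι K) (S : ι × ι × ι → K),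
      (∀ i j k, S (e i, f j, g k) = if i = j ∧ j = k then 1 else 0) ∧
      T = act (Matrix.extendRows e x) (Matrix.extendRows f y)
        (Matrix.extendRows g z) S := by
  obtain ⟨hA, hB, hC⟩ := linearIndependent_rows_of_act_eq_unit h
  obtain ⟨e, x, hx⟩ := A.exists_extendRows_mul_extendRows_eq_one hA
  obtain ⟨f, y, hy⟩ := B.exists_extendRows_mul_extendRows_eq_one hB
  obtain ⟨g, z, hz⟩ := C.exists_extendRows_mul_extendRows_eq_one hC
  refine ⟨e, f, g, x, y, z, act (Matrix.extendRows e A)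
    (Matrix.extendRows f B) (Matrix.extendRows g C) T, ?_, ?_⟩
  · intro i j k
    rw [← h i j k, act_apply, act_apply, Matrix.extendRows_apply, Matrix.extendRows_apply,
      Matrix.extendRows_apply]
  · rw [act_act, hx, hy, hz, act_one]

theorem exists_ne_zero_vanishing_of_embeddings [DecidableEq ι] (hr : 3 * Fintype.card ι < r ^ 2)
    (e f g : Fin r ↪ ι) :
    ∃ p : MvPolynomial (ι × ι × ι) K, p ≠ 0 ∧
      ∀ (x y z : Matrix (Fin r) ι K) (S : ι × ι × ι → K),
        (∀ i j k, S (e i, f j, g k) = if i = j ∧ j = k then 1 else 0) →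
        MvPolynomial.eval (act (Matrix.extendRows e x)
          (Matrix.extendRows f y) (Matrix.extendRows g z) S) p = 0 := by
  classical
  let E : Fin r × Fin r × Fin r ↪ ι × ι × ι := e.prodMap (f.prodMap g)
  -- Parameters: `3rn` matrix entries, and the entries of `S` outside the fixed block.
  let τ := ((Fin r × ι) ⊕ (Fin r × ι) ⊕ (Fin r × ι)) ⊕ {t : ι × ι × ι // t ∉ Set.range E}
  let c₁ (s : (Fin r × ι) ⊕ (Fin r × ι) ⊕ (Fin r × ι)) : MvPolynomial τ K :=
    MvPolynomial.X (Sum.inl s)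
  let S₀ (t : ι × ι × ι) : MvPolynomial τ K :=
    if h : t ∈ Set.range E then
      MvPolynomial.C (if h.choose.1 = h.choose.2.1 ∧ h.choose.2.1 = h.choose.2.2 then 1 else 0)
    else MvPolynomial.X (Sum.inr ⟨t, h⟩)
  let M (e : Fin r ↪ ι) (s : Fin r × ι → (Fin r × ι) ⊕ (Fin r × ι) ⊕ (Fin r × ι)) :
      Matrix ι ι (MvPolynomial τ K) := Matrix.extendRows e (Matrix.of fun i u => c₁ (s (i, u)))
  have hcard : Fintype.card τ < Fintype.card (ι × ι × ι) := by
    have hle := Fintype.card_le_of_embedding E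
    have hcompl : Fintype.card {t : ι × ι × ι // t ∉ Set.range E} =
        Fintype.card (ι × ι × ι) - Fintype.card (Fin r × Fin r × Fin r) := by
      rw [Fintype.card_subtype_compl]
      congr 1
      exact Set.card_range_of_injective E.injective
    have hr0 : 0 < r := by
      rcases Nat.eq_zero_or_pos r with rfl | h
      · simp at hr
      · exact h
    -- The count `3rn < r³` is the hypothesis times `r`, whence the need for `r > 0`.
    have hlt : r * Fintype.card ι + (r * Fintype.card ι + r * Fintype.card ι) < r * (r * r) := by
      nlinarith
    simp only [τ, Fintype.card_sum, hcompl]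
    simp only [Fintype.card_prod, Fintype.card_fin] at hle ⊢
    omega
  obtain ⟨p, hp0, hp⟩ := MvPolynomial.exists_ne_zero_of_card_lt hcard
    (act (M e Sum.inl) (M f (Sum.inr ∘ Sum.inl)) (M g (Sum.inr ∘ Sum.inr)) S₀)
  refine ⟨p, hp0, fun x y z S hS => ?_⟩
  let v : τ → K := Sum.elim (Sum.elim (fun s => x s.1 s.2)
    (Sum.elim (fun s => y s.1 s.2) fun s => z s.1 s.2)) fun t => S t
  have hM : ∀ (e : Fin r ↪ ι) (s : Fin r × ι → (Fin r × ι) ⊕ (Fin r × ι) ⊕ (Fin r × ι))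
      (x : Matrix (Fin r) ι K), (∀ i u, v (Sum.inl (s (i, u))) = x i u) →
      (M e s).map (MvPolynomial.eval v) = (Matrix.extendRows e x) := by
    intro e s x hx
    rw [Matrix.extendRows_map]
    congr 1
    ext i u
    simp [c₁, hx]
  have hS₀ : (fun t => MvPolynomial.eval v (S₀ t)) = S := by
    funext t
    by_cases ht : t ∈ Set.range E
    · simp only [S₀, dif_pos ht, MvPolynomial.eval_C]
      rw [← hS]
      exact congrArg S ht.choose_spec
    · simp only [S₀, dif_neg ht, MvPolynomial.eval_X, v, Sum.elim_inr]
  have := hp v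
  simp only [map_act] at this
  rw [hM e Sum.inl x fun _ _ => rfl, hM f (Sum.inr ∘ Sum.inl) y fun _ _ => rfl,
    hM g (Sum.inr ∘ Sum.inr) z fun _ _ => rfl, hS₀] at this
  exact this

end Parametrization

theorem exists_ne_zero_vanishing_of_restricts {K : Type*} [Field K] {n r : ℕ}
    (hr : 3 * n < r ^ 2) :
    ∃ p : MvPolynomial (Fin n × Fin n × Fin n) K, p ≠ 0 ∧
      ∀ T : Tensor3 K n n n, Restricts (unit K r) T →
        MvPolynomial.eval (fun x => T x.1 x.2.1 x.2.2) p = 0 := by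
  choose p hp0 hp using fun e : (Fin r ↪ Fin n) × (Fin r ↪ Fin n) × (Fin r ↪ Fin n) =>
    exists_ne_zero_vanishing_of_embeddings (K := K) (by simpa using hr) e.1 e.2.1 e.2.2
  refine ⟨∏ e, p e, Finset.prod_ne_zero_iff.2 fun e _ => hp0 e, fun T hT => ?_⟩
  obtain ⟨A, B, C, h⟩ := restricts_unit_iff.1 hT
  -- The positions of the rows depend on `T`, but only finitely many occur, so one product of
  -- polynomials serves all.
  obtain ⟨e, f, g, x, y, z, S, hS, hT⟩ := exists_eq_act_extendRows h
  rw [map_prod, hT]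
  exact Finset.prod_eq_zero (Finset.mem_univ (e, f, g)) (hp (e, f, g) x y z S hS)

/-! ### The generic subrank and its bounds -/

section Generic

variable {K : Type*} [Field K] {n r s : ℕ}

theorem Restricts.unit_mono {T : Tensor3 K n n n} (hsr : s ≤ r) (h : Restricts (unit K r) T) :
    Restricts (unit K s) T := by
  obtain ⟨A, B, C, h⟩ := h
  refine ⟨A.submatrix (Fin.castLE hsr) id, B.submatrix (Fin.castLE hsr) id,
    C.submatrix (Fin.castLE hsr) id, fun i j k => ?_⟩
  have := h (Fin.castLE hsr i) (Fin.castLE hsr j) (Fin.castLE hsr k)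
  simpa [unit, Fin.ext_iff] using this

theorem isZariskiOpen_eval_ne_zero (f : MvPolynomial (Fin n × Fin n × Fin n) K) :
    IsZariskiOpen
      {T : Tensor3 K n n n | MvPolynomial.eval (fun x => T x.1 x.2.1 x.2.2) f ≠ 0} := by
  refine ⟨{f}, ?_⟩
  ext T
  simp

theorem nonempty_eval_ne_zero [Infinite K] {f : MvPolynomial (Fin n × Fin n × Fin n) K}
    (hf : f ≠ 0) :
    {T : Tensor3 K n n n | MvPolynomial.eval (fun x => T x.1 x.2.1 x.2.2) f ≠ 0}.Nonempty := by
  by_contra hcon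
  rw [Set.not_nonempty_iff_eq_empty, Set.eq_empty_iff_forall_notMem] at hcon
  refine hf (MvPolynomial.funext fun x => ?_)
  simpa using hcon fun i j k => x (i, j, k)

/-- Over an algebraically closed field the arrays of subrank at least `r` contain a nonempty
principal open set or lie in a hypersurface. -/
theorem restricts_unit_dichotomy (K : Type*) [Field K] [IsAlgClosed K] (n r : ℕ) :
    ∃ f : MvPolynomial (Fin n × Fin n × Fin n) K, f ≠ 0 ∧
      ((∀ T : Tensor3 K n n n, MvPolynomial.eval (fun x => T x.1 x.2.1 x.2.2) f ≠ 0 →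
          Restricts (unit K r) T) ∨
        ∀ T : Tensor3 K n n n, Restricts (unit K r) T →
          MvPolynomial.eval (fun x => T x.1 x.2.1 x.2.2) f = 0) := by
  -- The outer variables are the entries of `A`, `B`, `C`, indexed by the leg `l`; the entries of
  -- `T` are the variables of the coefficient ring.
  let M (l : Fin 3) : Matrix (Fin r) (Fin n)
      (MvPolynomial (Fin 3 × Fin r × Fin n) (MvPolynomial (Fin n × Fin n × Fin n) K)) :=
    Matrix.of fun i a => MvPolynomial.X (l, i, a)
  let F (t : Fin r × Fin r × Fin r) :
      MvPolynomial (Fin 3 × Fin r × Fin n) (MvPolynomial (Fin n × Fin n × Fin n) K) :=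
    act (M 0) (M 1) (M 2) (fun x => MvPolynomial.C (MvPolynomial.X x)) t -
      if t.1 = t.2.1 ∧ t.2.1 = t.2.2 then 1 else 0
  obtain ⟨f, hf, h⟩ := MvPolynomial.exists_ne_zero_projection_dichotomy F
  have key : ∀ T : Tensor3 K n n n, Restricts (unit K r) T ↔
      ∃ y, ∀ t, MvPolynomial.eval₂ (MvPolynomial.eval fun x => T x.1 x.2.1 x.2.2) y (F t) = 0 := by
    intro T
    have hF : ∀ y t, MvPolynomial.eval₂ (MvPolynomial.eval fun x => T x.1 x.2.1 x.2.2) y (F t) =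
        act (Matrix.of fun i a => y (0, i, a)) (Matrix.of fun i a => y (1, i, a))
          (Matrix.of fun i a => y (2, i, a)) (fun x => T x.1 x.2.1 x.2.2) t -
          if t.1 = t.2.1 ∧ t.2.1 = t.2.2 then 1 else 0 := by
      intro y t
      rw [← MvPolynomial.coe_eval₂Hom]
      simp only [F, map_sub, map_act, apply_ite (MvPolynomial.eval₂Hom _ y), map_one, map_zero,
        MvPolynomial.coe_eval₂Hom, MvPolynomial.eval₂_C, MvPolynomial.eval_X]
      congr 2 <;> ext i a <;> simp [M]
    rw [restricts_unit_iff]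
    constructor
    · rintro ⟨A, B, C, h⟩
      refine ⟨fun x => ![A, B, C] x.1 x.2.1 x.2.2, fun ⟨i, j, k⟩ => ?_⟩
      rw [hF, sub_eq_zero]
      exact h i j k
    · rintro ⟨y, hy⟩
      refine ⟨_, _, _, fun i j k => sub_eq_zero.1 ((hF y (i, j, k)).symm.trans (hy _))⟩
  refine ⟨f, hf, h.imp (fun h T hT => (key T).2 (h _ hT)) fun h T hT => h _ ((key T).1 hT)⟩

theorem exists_isGenericSubrank (K : Type*) [Field K] [IsAlgClosed K] (n : ℕ) :
    ∃ r, IsGenericSubrank K n n n r := by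
  classical
  let G (r : ℕ) : Prop := ∃ f : MvPolynomial (Fin n × Fin n × Fin n) K, f ≠ 0 ∧
    ∀ T : Tensor3 K n n n, MvPolynomial.eval (fun x => T x.1 x.2.1 x.2.2) f ≠ 0 →
      Restricts (unit K r) T
  have hG0 : G 0 := ⟨1, one_ne_zero, fun T _ => ⟨0, 0, 0, fun i => i.elim0⟩⟩
  have hGle : ∀ r, G r → r ≤ n := by
    rintro r ⟨f, hf, h⟩
    obtain ⟨T, hT⟩ := nonempty_eval_ne_zero hf
    exact (h T hT).unit_le
  let q := Nat.findGreatest G n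
  obtain ⟨f, hf, hfT⟩ : G q := Nat.findGreatest_spec (Nat.zero_le n) hG0
  obtain ⟨g, hg, hgT⟩ := restricts_unit_dichotomy K n (q + 1)
  have hgT : ∀ T : Tensor3 K n n n, Restricts (unit K (q + 1)) T →
      MvPolynomial.eval (fun x => T x.1 x.2.1 x.2.2) g = 0 := by
    -- The first alternative at `q + 1` would contradict the maximality of `q`; the search bound `n`
    -- is harmless by `hGle`.
    refine hgT.resolve_left fun h => ?_
    have hGq : G (q + 1) := ⟨g, hg, h⟩
    exact Nat.findGreatest_is_greatest (Nat.lt_succ_self q) (hGle _ hGq) hGq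
  refine ⟨q, _, nonempty_eval_ne_zero (mul_ne_zero hf hg), isZariskiOpen_eval_ne_zero _,
    fun T hT => ?_⟩
  rw [Set.mem_ofPred_eq, map_mul] at hT
  have hgr := subrank_isGreatest T
  refine le_antisymm (Nat.le_of_lt_succ (lt_of_not_ge fun hle => ?_))
    (hgr.2 (hfT T (left_ne_zero_of_mul hT)))
  exact right_ne_zero_of_mul hT (hgT T (Restricts.unit_mono hle hgr.1))

theorem IsGenericSubrank.three_mul_le [IsAlgClosed K] {q m : ℕ} (hq : IsGenericSubrank K n n n q)
    (hmn : 3 * m * (m + 1) ≤ n) : 3 * m ≤ q := by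
  obtain ⟨f, hf, h⟩ := restricts_unit_dichotomy K n (3 * m)
  have h := h.resolve_right fun h => hf (eq_zero_of_forall_restricts_unit hmn f h)
  obtain ⟨U, hU, hUo, hUq⟩ := hq
  obtain ⟨T, hTU, hT⟩ := hUo.inter_nonempty (isZariskiOpen_eval_ne_zero f) hU
    (nonempty_eval_ne_zero hf)
  rw [← hUq T hTU]
  exact (subrank_isGreatest T).2 (h T hT)

theorem IsGenericSubrank.sq_le [Infinite K] {q : ℕ} (hq : IsGenericSubrank K n n n q) :
    q ^ 2 ≤ 3 * n := by
  by_contra! hlt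
  obtain ⟨p, hp, h⟩ := exists_ne_zero_vanishing_of_restricts (K := K) hlt
  obtain ⟨U, hU, hUo, hUq⟩ := hq
  obtain ⟨T, hTU, hT⟩ := hUo.inter_nonempty (isZariskiOpen_eval_ne_zero p) hU
    (nonempty_eval_ne_zero hp)
  refine hT (h T ?_)
  rw [← hUq T hTU]
  exact (subrank_isGreatest T).1

theorem isGenericSubrank_genericSubrank (K : Type*) [Field K] [IsAlgClosed K] (n : ℕ) :
    IsGenericSubrank K n n n (genericSubrank K n n n) := by
  obtain ⟨r, hr⟩ := exists_isGenericSubrank K n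
  rwa [hr.genericSubrank_eq]

theorem three_mul_floor_le_genericSubrank (K : Type*) [Field K] [IsAlgClosed K] (n : ℕ) :
    3 * ⌊√((n : ℝ) / 3 + 1 / 4) - 1 / 2⌋ ≤ (genericSubrank K n n n : ℤ) := by
  have hhalf : (1 / 2 : ℝ) ≤ √((n : ℝ) / 3 + 1 / 4) := by
    apply Real.le_sqrt_of_sq_le
    have : (0 : ℝ) ≤ n := n.cast_nonneg
    linarith
  obtain ⟨m, hm⟩ := Int.eq_ofNat_of_zero_le
    (Int.floor_nonneg.2 (sub_nonneg.2 hhalf) : 0 ≤ ⌊√((n : ℝ) / 3 + 1 / 4) - 1 / 2⌋)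
  have hle : (m : ℝ) + 1 / 2 ≤ √((n : ℝ) / 3 + 1 / 4) := by
    have := Int.floor_le (√((n : ℝ) / 3 + 1 / 4) - 1 / 2)
    rw [hm] at this
    push_cast at this
    linarith
  -- Squaring `m + 1/2 ≤ √(n/3 + 1/4)` gives `m² + m ≤ n/3`.
  have hsq := (Real.le_sqrt' (by positivity)).1 hle
  have hmn : 3 * m * (m + 1) ≤ n := by
    have : (3 * m * (m + 1) : ℝ) ≤ n := by nlinarith
    exact_mod_cast this
  rw [hm]
  exact_mod_cast (isGenericSubrank_genericSubrank K n).three_mul_le hmn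

theorem genericSubrank_le_sqrt (K : Type*) [Field K] [IsAlgClosed K] (n : ℕ) :
    (genericSubrank K n n n : ℝ) ≤ √3 * √n := by
  rw [← Real.sqrt_mul (by norm_num)]
  apply Real.le_sqrt_of_sq_le
  exact_mod_cast (isGenericSubrank_genericSubrank K n).sq_le

theorem sqrt_le_genericSubrank (K : Type*) [Field K] [IsAlgClosed K] {n : ℕ} (hn : 100 ≤ n) :
    √n ≤ (genericSubrank K n n n : ℝ) := by
  have h1 : (3 * ⌊√((n : ℝ) / 3 + 1 / 4) - 1 / 2⌋ : ℝ) ≤ genericSubrank K n n n := by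
    exact_mod_cast three_mul_floor_le_genericSubrank K n
  -- With `h4`, three times the floor exceeds `(3/2)√n - 9/2`, which is at least `√n` once `√n ≥ 9`.
  have h2 := Int.lt_floor_add_one (√((n : ℝ) / 3 + 1 / 4) - 1 / 2)
  have h3 : (10 : ℝ) ≤ √n := by
    apply Real.le_sqrt_of_sq_le
    norm_num
    exact_mod_cast hn
  have h4 : (1 / 2 : ℝ) * √n ≤ √((n : ℝ) / 3 + 1 / 4) := by
    apply Real.le_sqrt_of_sq_le
    have : (0 : ℝ) ≤ n := n.cast_nonneg
    rw [mul_pow, Real.sq_sqrt this]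
    linarith
  linarith

end Generic

end Tensor3

theorem theorem1p3 (K : Type*) [Field K] [IsAlgClosed K] :
    (∀ n : ℕ,
      Tensor3.IsGenericSubrank K n n n (Tensor3.genericSubrank K n n n) ∧
      3 * ⌊√((n : ℝ) / 3 + 1 / 4) - 1 / 2⌋ ≤ (Tensor3.genericSubrank K n n n : ℤ)) ∧
    (fun n : ℕ => (Tensor3.genericSubrank K n n n : ℝ)) =Θ[atTop] (fun n : ℕ => √(n : ℝ)) := by
  refine ⟨fun n => ⟨Tensor3.isGenericSubrank_genericSubrank K n,
    Tensor3.three_mul_floor_le_genericSubrank K n⟩, ?_, ?_⟩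
  · refine IsBigO.of_bound (√3) (Eventually.of_forall fun n => ?_)
    rw [Real.norm_of_nonneg (by positivity), Real.norm_of_nonneg (by positivity)]
    exact Tensor3.genericSubrank_le_sqrt K n
  · refine IsBigO.of_bound 1 (eventually_atTop.2 ⟨100, fun n hn => ?_⟩)
    rw [Real.norm_of_nonneg (by positivity), Real.norm_of_nonneg (by positivity), one_mul]
    exact Tensor3.sqrt_le_genericSubrank K hn
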